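/- Let $G$ be a locally compact, second countable, Hausdorff topological group with identity $e$. A *(principal) frame* $\mathcal R$ for $G$ consists of a separable complex Hilbert space $\mathcal H$, a strongly continuous (possibly projective) unitary representation $U$ of $G$ on $\mathcal H$, and a POVM $\mathsf E:\mathcal B(G)\to B(\mathcal H)$ on the Borel sets of $G$ with $\mathsf E(gX)=U(g)\mathsf E(X)U(g)^*$ for all $g\in G$, $X\in\mathcal B(G)$. Here a POVM is a map $\mathsf E$ such that for every density operator $\omega$ the assignment $\mu^{\mathsf E}_\omega(X)=\mathrm{tr}[\omega\,\mathsf E(X)]$ is a probability measure. The frame is *localizable* if for every Borel set $X$ with $\mathsf E(X)\neq 0$ and every $\varepsilon>0$ there is a unit vector $\xi$ with $\langle\xi,\mathsf E(X)\xi\rangle>1-\varepsilon$. A *localizing sequence* (centered at $e$) is a sequence of pure states $\omega_n=|\xi_n\rangle\langle\xi_n|$, $\|\xi_n\|=1$, such that $\mu^{\mathsf E}_{\omega_n}\to\delta_e$ weakly. For $g\in G$ write $g.A=U(g)AU(g)^*$ for operators $A$ and $g.\rho=U(g)^*\rho\,U(g)$ for states $\rho$. Let $\mathcal R_1,\mathcal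 R_2$ be localizable frames for $G$ on $\mathcal H_1,\mathcal H_2$ with observables $\mathsf E_1,\mathsf E_2$ and representations $U_1,U_2$, and let $(\omega_n)$, $(\rho_m)$ be localizing sequences for $\mathcal R_1$, $\mathcal R_2$ respectively. Then there is a POVM $\mathsf E_2*\mathsf E_1$ on $\mathcal B(G)$ with values in $B(\mathcal H_1\otimes\mathcal H_2)$ (Hilbert space tensor product), the relative-orientation observable $$(\mathsf E_2*\mathsf E_1)(X)=\text{¥}^{\mathcal R_1}(\mathsf E_2(X))=\int_G d\mathsf E_1(g)\otimes U_2(g)\,\mathsf E_2(X)\,U_2(g)^*,\qquad X\in\mathcal B(G),$$ where the integral is the unique bounded operator $T$ with $\mathrm{tr}[(\omega\otimes\rho)T]=\int_G\mathrm{tr}[\rho\,(g.\mathsf E_2(X))]\,d\mu^{\mathsf E_1}_\omega(g)$ for all pure states $\omega$ of $\mathcal H_1$ and $\rho$ of $\mathcal H_2$. Moreover, for every $h\in G$, with $\Omega_{n,m}(h)=\omega_n\otimes h^{-1}.\rho_m$, $$\lim_{n,m\to\infty}\mu^{\mathsf E_2*\mathsf E_1}_{\Omega_{n,m}(h)}=\delta_h$$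 in the sense of weak convergence of probability measures, as a joint (double) limit in $n$ and $m$. -/

import Mathlib

open MeasureTheory Filter Topology
open scoped TensorProduct InnerProductSpace Pointwise

namespace QRF

noncomputable section

/-- The Hilbert space tensor product: the completion of the algebraic tensor product for the
inner product with `⟪ξ ⊗ₜ η, ξ' ⊗ₜ η'⟫ = ⟪ξ, ξ'⟫ * ⟪η, η'⟫`. -/
abbrev HilbertTensor (H₁ H₂ : Type*)
    [NormedAddCommGroup H₁] [InnerProductSpace ℂ H₁]
    [NormedAddCommGroup H₂] [InnerProductSpace ℂ H₂] : Type _ :=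
  UniformSpace.Completion (H₁ ⊗[ℂ] H₂)

section States

variable {H : Type*} [NormedAddCommGroup H] [InnerProductSpace ℂ H] [CompleteSpace H]

/-- The trace `∑ i, ⟪b i, T (b i)⟫` of an operator, computed in some Hilbert basis `b`
(on trace-class operators the choice of the basis is irrelevant). -/
def trace (T : H →L[ℂ] H) : ℂ :=
  ∑' i, ⟪(exists_hilbertBasis ℂ H).choose_spec.choose i,
    T ((exists_hilbertBasis ℂ H).choose_spec.choose i)⟫_ℂ

/-- For `ω = |ξ⟩⟨ξ|` one has `tr (ω A) = ⟪ξ, A ξ⟫`. -/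
theorem trace_rankOne_mul (ξ : H) (A : H →L[ℂ] H) :
    trace (InnerProductSpace.rankOne ℂ ξ ξ * A) = ⟪ξ, A ξ⟫_ℂ := by
  unfold trace
  set b := (exists_hilbertBasis ℂ H).choose_spec.choose
  rw [← ContinuousLinearMap.adjoint_inner_left, ← b.tsum_inner_mul_inner]
  refine tsum_congr fun i => ?_
  simp [ContinuousLinearMap.adjoint_inner_left]

variable (H) in
/-- Quantum states: density operators, i.e. positive operators of trace one. (If the series that
defines the trace does not converge its value is `0`, so `trace_op` forces trace class.) -/
structure State where
  op : H →L[ℂ] H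
  isPositive : op.IsPositive
  trace_op : trace op = 1

variable (H) in
/-- Pure states: the one-dimensional projections `|ξ⟩⟨ξ|`, with `ξ` a unit vector. -/
structure PureState where
  op : H →L[ℂ] H
  exists_vector : ∃ ξ : H, ‖ξ‖ = 1 ∧ op = InnerProductSpace.rankOne ℂ ξ ξ

/-- A pure state is a density operator. -/
def PureState.toState (ω : PureState H) : State H where
  op := ω.op
  isPositive := by
    obtain ⟨ξ, -, h⟩ := ω.exists_vector
    rw [h]
    exact InnerProductSpace.isPositive_rankOne_self ξ
  trace_op := by
    obtain ⟨ξ, hξ, h⟩ := ω.exists_vector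
    rw [h, ← mul_one (InnerProductSpace.rankOne ℂ ξ ξ), trace_rankOne_mul]
    simp [inner_self_eq_norm_sq_to_K, hξ]

/-- `μ` is the probability distribution `X ↦ tr (ω E(X))` of the operator measure `E` in the
state `ω` (Born rule). -/
def HasDistribution {S : Type*} [MeasurableSpace S] (E : Set S → H →L[ℂ] H) (ω : State H)
    (μ : ProbabilityMeasure S) : Prop :=
  ∀ X, MeasurableSet X → ((μ X : ℝ) : ℂ) = trace (ω.op * E X)

end States

section Observables

/-- A positive operator-valued measure on the measurable space `S`: an assignment of operators
`E(X)` to the measurable sets `X` such that, in every state `ω`, the assignment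
`X ↦ tr (ω E(X))` is a probability measure. (Values on non-measurable sets are irrelevant.) -/
structure POVM (S : Type*) [MeasurableSpace S]
    (H : Type*) [NormedAddCommGroup H] [InnerProductSpace ℂ H] [CompleteSpace H] where
  effect : Set S → H →L[ℂ] H
  exists_distribution : ∀ ω : State H, ∃ μ : ProbabilityMeasure S, HasDistribution effect ω μ

variable {S : Type*} [MeasurableSpace S]
  {H : Type*} [NormedAddCommGroup H] [InnerProductSpace ℂ H] [CompleteSpace H]

/-- The probability measure `X ↦ tr (ω E(X))` of the observable `E` in the state `ω`. -/
def POVM.distribution (E : POVM S H) (ω : State H) : ProbabilityMeasure S :=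
  (E.exists_distribution ω).choose

theorem POVM.distribution_spec (E : POVM S H) (ω : State H) :
    HasDistribution E.effect ω (E.distribution ω) :=
  (E.exists_distribution ω).choose_spec

/-- `E` is localizable: every effect `E(X) ≠ 0` is almost certain in some pure state. -/
def POVM.IsLocalizable (E : POVM S H) : Prop :=
  ∀ X, MeasurableSet X → E.effect X ≠ 0 → ∀ ε : ℝ, 0 < ε →
    ∃ ξ : H, ‖ξ‖ = 1 ∧ 1 - ε < (⟪ξ, E.effect X ξ⟫_ℂ).re

/-- `ω` is a localizing sequence for `E` centered at `x`: a sequence of pure states whose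
distributions converge weakly to the Dirac measure at `x`. -/
def POVM.IsLocalizingSequence [TopologicalSpace S] [OpensMeasurableSpace S]
    (E : POVM S H) (x : S) (ω : ℕ → PureState H) : Prop :=
  Tendsto (fun n => E.distribution (ω n).toState) atTop (𝓝 (diracProba x))

end Observables

section Tensor

variable {H₁ : Type*} [NormedAddCommGroup H₁] [InnerProductSpace ℂ H₁]
  {H₂ : Type*} [NormedAddCommGroup H₂] [InnerProductSpace ℂ H₂]

/-- The tensor product `A ⊗ B` of bounded operators, on the Hilbert tensor product. -/
def opTensor (A : H₁ →L[ℂ] H₁) (B : H₂ →L[ℂ] H₂) :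
    HilbertTensor H₁ H₂ →L[ℂ] HilbertTensor H₁ H₂ :=
  ((UniformSpace.Completion.toComplL (𝕜 := ℂ) (E := H₁ ⊗[ℂ] H₂)).comp
    (TensorProduct.mapL A B)).extend UniformSpace.Completion.toComplL

theorem opTensor_coe (A : H₁ →L[ℂ] H₁) (B : H₂ →L[ℂ] H₂) (x : H₁ ⊗[ℂ] H₂) :
    opTensor A B (x : HilbertTensor H₁ H₂) =
      ((TensorProduct.map A.toLinearMap B.toLinearMap x : H₁ ⊗[ℂ] H₂) : HilbertTensor H₁ H₂) := by
  have h := ContinuousLinearMap.extend_eq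
    ((UniformSpace.Completion.toComplL (𝕜 := ℂ) (E := H₁ ⊗[ℂ] H₂)).comp (TensorProduct.mapL A B))
    (e := UniformSpace.Completion.toComplL) UniformSpace.Completion.denseRange_coe
    (UniformSpace.Completion.isUniformInducing_coe _) x
  simpa [opTensor] using h

theorem opTensor_rankOne (ξ : H₁) (η : H₂) :
    opTensor (InnerProductSpace.rankOne ℂ ξ ξ) (InnerProductSpace.rankOne ℂ η η) =
      InnerProductSpace.rankOne ℂ ((ξ ⊗ₜ[ℂ] η : H₁ ⊗[ℂ] H₂) : HilbertTensor H₁ H₂)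
        ((ξ ⊗ₜ[ℂ] η : H₁ ⊗[ℂ] H₂) : HilbertTensor H₁ H₂) := by
  ext x
  induction x using UniformSpace.Completion.induction_on with
  | hp => exact isClosed_eq (ContinuousLinearMap.continuous _) (ContinuousLinearMap.continuous _)
  | ih x =>
    rw [opTensor_coe]
    simp only [InnerProductSpace.rankOne_apply, UniformSpace.Completion.inner_coe]
    rw [← UniformSpace.Completion.coe_smul]
    congr 1
    induction x with
    | zero => simp
    | tmul a b =>
      simp [← TensorProduct.smul_tmul', smul_smul, mul_comm]
    | add x y hx hy => rw [map_add, hx, hy, inner_add_right, add_smul]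

/-- The product `ω ⊗ ρ` of two pure states. -/
def PureState.tensor (ω : PureState H₁) (ρ : PureState H₂) : PureState (HilbertTensor H₁ H₂) where
  op := opTensor ω.op ρ.op
  exists_vector := by
    obtain ⟨ξ, hξ, h₁⟩ := ω.exists_vector
    obtain ⟨η, hη, h₂⟩ := ρ.exists_vector
    refine ⟨((ξ ⊗ₜ[ℂ] η : H₁ ⊗[ℂ] H₂) : HilbertTensor H₁ H₂), ?_, ?_⟩
    · simp [UniformSpace.Completion.norm_coe, hξ, hη]
    · rw [h₁, h₂, opTensor_rankOne]

variable [CompleteSpace H₁] [CompleteSpace H₂] {S : Type*} [MeasurableSpace S]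

/-- `T = ∫ dE(s) ⊗ F(s)`, as a weak integral: in every product state `ω ⊗ ρ` (of pure states)
one has `tr ((ω ⊗ ρ) T) = ∫ tr (ρ F(s)) dμ(s)` with `μ` the distribution of `E` in the state `ω`.
There is at most one such `T`, see `IsTensorIntegral.unique`. -/
def IsTensorIntegral (E : POVM S H₁) (F : S → H₂ →L[ℂ] H₂)
    (T : HilbertTensor H₁ H₂ →L[ℂ] HilbertTensor H₁ H₂) : Prop :=
  ∀ (ω : PureState H₁) (ρ : PureState H₂),
    trace ((ω.tensor ρ).op * T) =
      ∫ s, trace (ρ.op * F s) ∂(E.distribution ω.toState : Measure S)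

/-- Two operators whose mixed quadratic form vanishes have vanishing mixed sesquilinear form. -/
theorem polar {H K : Type*} [NormedAddCommGroup H] [InnerProductSpace ℂ H] [CompleteSpace H]
    [NormedAddCommGroup K] [InnerProductSpace ℂ K] [CompleteSpace K]
    (A B : H →L[ℂ] K) (h : ∀ x, ⟪A x, B x⟫_ℂ = 0) (x y : H) : ⟪A x, B y⟫_ℂ = 0 := by
  have h0 : ((A.adjoint.comp B : H →L[ℂ] H) : H →ₗ[ℂ] H) = 0 := by
    refine (inner_map_self_eq_zero _).1 fun z => ?_
    rw [← inner_conj_symm]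
    simp [ContinuousLinearMap.adjoint_inner_right, h]
  have h1 := congrArg (fun L : H →ₗ[ℂ] H => ⟪x, L y⟫_ℂ) h0
  simpa [ContinuousLinearMap.adjoint_inner_right] using h1

/-- The weak integral `∫ dE(s) ⊗ F(s)` is unique. -/
theorem IsTensorIntegral.unique {E : POVM S H₁} {F : S → H₂ →L[ℂ] H₂}
    {T T' : HilbertTensor H₁ H₂ →L[ℂ] HilbertTensor H₁ H₂}
    (hT : IsTensorIntegral E F T) (hT' : IsTensorIntegral E F T') : T = T' := by
  let j : H₁ →L[ℂ] H₂ →L[ℂ] H₁ ⊗[ℂ] H₂ := TensorProduct.mkL ℂ H₁ H₂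
  let c : H₁ ⊗[ℂ] H₂ →L[ℂ] HilbertTensor H₁ H₂ := UniformSpace.Completion.toComplL
  have unit : ∀ (ξ : H₁) (η : H₂), ‖ξ‖ = 1 → ‖η‖ = 1 →
      ⟪c (j ξ η), (T - T') (c (j ξ η))⟫_ℂ = 0 := by
    intro ξ η hξ hη
    have h := (hT ⟨_, ξ, hξ, rfl⟩ ⟨_, η, hη, rfl⟩).trans (hT' ⟨_, ξ, hξ, rfl⟩ ⟨_, η, hη, rfl⟩).symm
    simp only [PureState.tensor, opTensor_rankOne, trace_rankOne_mul] at h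
    rw [sub_apply, inner_sub_right, sub_eq_zero]
    exact h
  have diag : ∀ (ξ : H₁) (η : H₂), ⟪c (j ξ η), (T - T') (c (j ξ η))⟫_ℂ = 0 := by
    intro ξ η
    rcases eq_or_ne ξ 0 with rfl | hξ
    · simp
    rcases eq_or_ne η 0 with rfl | hη
    · simp
    have h := unit ((‖ξ‖⁻¹ : ℂ) • ξ) ((‖η‖⁻¹ : ℂ) • η) (norm_smul_inv_norm hξ)
      (norm_smul_inv_norm hη)
    simpa [inner_smul_left, inner_smul_right, hξ, hη] using h
  have left : ∀ (ξ ξ' : H₁) (η : H₂), ⟪c (j ξ η), (T - T') (c (j ξ' η))⟫_ℂ = 0 := fun ξ ξ' η =>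
    polar (c.comp (j.flip η)) ((T - T').comp (c.comp (j.flip η))) (fun x => diag x η) ξ ξ'
  have full : ∀ (ξ ξ' : H₁) (η η' : H₂), ⟪c (j ξ η), (T - T') (c (j ξ' η'))⟫_ℂ = 0 :=
    fun ξ ξ' η η' => polar (c.comp (j ξ)) ((T - T').comp (c.comp (j ξ'))) (left ξ ξ') η η'
  have zero : ∀ x y : H₁ ⊗[ℂ] H₂, ⟪c x, (T - T') (c y)⟫_ℂ = 0 := by
    intro x y
    induction x with
    | zero => simp
    | add a b ha hb => rw [map_add, inner_add_left, ha, hb, add_zero]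
    | tmul a b =>
      induction y with
      | zero => simp
      | add a b ha hb => rw [map_add, map_add, inner_add_right, ha, hb, add_zero]
      | tmul a' b' => exact full a a' b b'
  rw [← sub_eq_zero]
  ext y
  induction y using UniformSpace.Completion.induction_on with
  | hp => exact isClosed_eq (ContinuousLinearMap.continuous _) continuous_const
  | ih y =>
    refine ext_inner_left ℂ fun x => ?_
    rw [zero_apply, inner_zero_right]
    induction x using UniformSpace.Completion.induction_on with
    | hp => exact isClosed_eq (by fun_prop) continuous_const
    | ih x => exact zero x y

end Tensor

section Frames

/-- A strongly continuous projective unitary representation of `G` on `H`: unitary operators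
`U(g)`, strongly continuous in `g`, with `U(gh) = c U(g) U(h)` for phases `c = c(g, h)`
(an ordinary unitary representation when every `c` is `1`). -/
structure ProjRep (G : Type*) [Group G] [TopologicalSpace G]
    (H : Type*) [NormedAddCommGroup H] [InnerProductSpace ℂ H] [CompleteSpace H] where
  U : G → unitary (H →L[ℂ] H)
  map_mul : ∀ g h : G, ∃ c : ℂ, ‖c‖ = 1 ∧
    (U (g * h) : H →L[ℂ] H) = c • ((U g : H →L[ℂ] H) * (U h : H →L[ℂ] H))
  strongly_continuous : ∀ ξ : H, Continuous fun g => (U g : H →L[ℂ] H) ξ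

variable {G : Type*} [Group G] [TopologicalSpace G]
  {H : Type*} [NormedAddCommGroup H] [InnerProductSpace ℂ H] [CompleteSpace H]

/-- The action `g.A = U(g) A U(g)*` on operators. -/
def ProjRep.act (V : ProjRep G H) (g : G) (A : H →L[ℂ] H) : H →L[ℂ] H :=
  (V.U g : H →L[ℂ] H) * A * star (V.U g : H →L[ℂ] H)

/-- The dual action `g.ρ = U(g)* ρ U(g)` on (pure) states. -/
def ProjRep.actState (V : ProjRep G H) (g : G) (ρ : PureState H) : PureState H where
  op := star (V.U g : H →L[ℂ] H) * ρ.op * (V.U g : H →L[ℂ] H)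
  exists_vector := by
    obtain ⟨ξ, hξ, h⟩ := ρ.exists_vector
    refine ⟨star (V.U g : H →L[ℂ] H) ξ, ?_, ?_⟩
    · have hU : (V.U g : H →L[ℂ] H) * star (V.U g : H →L[ℂ] H) = 1 := Unitary.coe_mul_star_self _
      have h2 : ‖star (V.U g : H →L[ℂ] H) ξ‖ ^ 2 = ‖ξ‖ ^ 2 := by
        rw [← inner_self_eq_norm_sq (𝕜 := ℂ), ← inner_self_eq_norm_sq (𝕜 := ℂ)]
        conv_lhs => rw [ContinuousLinearMap.star_eq_adjoint]
        rw [ContinuousLinearMap.adjoint_inner_left, ← ContinuousLinearMap.star_eq_adjoint,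
          ← mul_apply_eq_comp, hU, one_apply_eq_self]
      rw [hξ] at h2
      nlinarith [norm_nonneg (star (V.U g : H →L[ℂ] H) ξ)]
    · ext x
      rw [h]
      simp [ContinuousLinearMap.star_eq_adjoint, ContinuousLinearMap.adjoint_inner_left]

/-- A (principal) quantum reference frame for `G` on `H`: a POVM on the Borel sets of `G` that is
covariant, `E(gX) = U(g) E(X) U(g)*`, for a projective unitary representation `U`. -/
structure Frame (G : Type*) [Group G] [TopologicalSpace G] [MeasurableSpace G]
    (H : Type*) [NormedAddCommGroup H] [InnerProductSpace ℂ H] [CompleteSpace H] where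
  rep : ProjRep G H
  observable : POVM G H
  covariant : ∀ (g : G) (X : Set G), MeasurableSet X →
    observable.effect (g • X) = rep.act g (observable.effect X)

variable {H₁ : Type*} [NormedAddCommGroup H₁] [InnerProductSpace ℂ H₁] [CompleteSpace H₁]
  {H₂ : Type*} [NormedAddCommGroup H₂] [InnerProductSpace ℂ H₂] [CompleteSpace H₂]
  [MeasurableSpace G]

/-- `T` is the relativization `∫ dE(g) ⊗ U(g) A U(g)*` of the operator `A` with respect to the
frame `R`, where `U` is the representation `V` on the space of `A`. -/
def Frame.IsRelativization (R : Frame G H₁) (V : ProjRep G H₂) (A : H₂ →L[ℂ] H₂)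
    (T : HilbertTensor H₁ H₂ →L[ℂ] HilbertTensor H₁ H₂) : Prop :=
  IsTensorIntegral R.observable (fun g => V.act g A) T

/-- `E` is the observable `E₂ * E₁ = ∫ dE₁(g) ⊗ g.E₂(·)` of relative orientation of `R₂` with
respect to `R₁`: the effects of `E` are the relativizations of the effects of `E₂`. -/
def IsRelativeOrientation (R₁ : Frame G H₁) (R₂ : Frame G H₂)
    (E : POVM G (HilbertTensor H₁ H₂)) : Prop :=
  ∀ X, MeasurableSet X →
    R₁.IsRelativization R₂.rep (R₂.observable.effect X) (E.effect X)

end Frames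

end

end QRF

/-! In a product state of `ω` and `ρ`, the covariance g.E₂(X) = E₂(gX) turns the defining integral
into ∫ ν(gX) dμ(g), where μ and ν are the distributions of E₁ in `ω` and of E₂ in `ρ`. By Fubini
this is the probability that g⁻¹k lies in X for independent g ∼ μ and k ∼ ν (`relativeLaw`,
`trace_relativization`). The limit follows: forming the product measure and pushing it forward along
(g, k) ↦ g⁻¹k are weakly continuous, the state h⁻¹.ρ_m has the law of ρ_m translated by h, and δ_e,
δ_h combine to δ_h.

The longer task is to construct the observable. For each X the effect is a weak limit, along an
ultrafilter, of finite sums of E₁(fiber) ⊗ F(value); continuity of g ↦ g.E₂(X) in the weak sense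
identifies its values on product vectors (`exists_isTensorIntegral`). Product states determine the
operator, so finite additivity in X is inherited from the relative laws. A POVM needs a probability
measure in every state, including entangled and mixed ones. Countable additivity passes from product
vectors to all vectors by density and boundedness (`tendsto_inner_zero_of_tmul`), and from vectors
to density operators by writing the latter as mixtures of vector states (`State.exists_vectors`). -/

namespace QRF

open scoped ComplexOrder

noncomputable section

/-! ### Quadratic forms, operator order and weak compactness -/

section Operators

variable {H : Type*} [NormedAddCommGroup H] [InnerProductSpace ℂ H] [CompleteSpace H]

/-- The pure state of a unit vector. -/
def PureState.ofUnit (ξ : H) (hξ : ‖ξ‖ = 1) : PureState H :=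
  ⟨InnerProductSpace.rankOne ℂ ξ ξ, ξ, hξ, rfl⟩

theorem eq_zero_of_inner_unit {T : H →L[ℂ] H} (h : ∀ ξ : H, ‖ξ‖ = 1 → ⟪ξ, T ξ⟫_ℂ = 0) :
    T = 0 := by
  have h0 : ∀ x y : H, ⟪x, T y⟫_ℂ = 0 := polar (1 : H →L[ℂ] H) T fun x => by
    rcases eq_or_ne x 0 with rfl | hx
    · simp
    have := h ((‖x‖⁻¹ : ℂ) • x) (norm_smul_inv_norm hx)
    simpa [inner_smul_left, inner_smul_right, hx] using this
  ext y
  exact ext_inner_left ℂ fun x => by simp [h0]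

theorem eq_of_inner_unit {S T : H →L[ℂ] H}
    (h : ∀ ξ : H, ‖ξ‖ = 1 → ⟪ξ, S ξ⟫_ℂ = ⟪ξ, T ξ⟫_ℂ) : S = T :=
  sub_eq_zero.1 <| eq_zero_of_inner_unit fun ξ hξ => by simp [h ξ hξ]

omit [CompleteSpace H] in
theorem nonneg_iff_inner {T : H →L[ℂ] H} :
    0 ≤ T ↔ ∀ x, 0 ≤ ⟪x, T x⟫_ℂ := by
  rw [ContinuousLinearMap.nonneg_iff_isPositive]
  refine ⟨fun h x => h.inner_nonneg_right x, fun h => ?_⟩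
  rw [ContinuousLinearMap.isPositive_iff_complex]
  intro x
  have h1 := h x
  rw [Complex.nonneg_iff] at h1
  have h2 : ⟪T x, x⟫_ℂ = ⟪x, T x⟫_ℂ := by
    rw [← inner_conj_symm]
    exact Complex.conj_eq_iff_im.2 h1.2.symm
  rw [h2]
  exact ⟨Complex.ext (by simp) (by simpa using h1.2), h1.1⟩

omit [CompleteSpace H] in
theorem re_inner_nonneg {T : H →L[ℂ] H} (hT : 0 ≤ T) (x : H) : 0 ≤ (⟪x, T x⟫_ℂ).re :=
  (Complex.nonneg_iff.1 (nonneg_iff_inner.1 hT x)).1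

theorem re_inner_le_norm_sq {T : H →L[ℂ] H} (hT : T ≤ 1) (x : H) :
    (⟪x, T x⟫_ℂ).re ≤ ‖x‖ ^ 2 := by
  have := re_inner_nonneg (sub_nonneg.2 hT) x
  rw [sub_apply, inner_sub_right, Complex.sub_re, one_apply_eq_self] at this
  have h2 : (⟪x, x⟫_ℂ).re = ‖x‖ ^ 2 := inner_self_eq_norm_sq (𝕜 := ℂ) x
  linarith

omit [CompleteSpace H] in
theorem nonneg_of_inner_unit {T : H →L[ℂ] H} (h : ∀ ξ : H, ‖ξ‖ = 1 → 0 ≤ ⟪ξ, T ξ⟫_ℂ) :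
    0 ≤ T := by
  refine nonneg_iff_inner.2 fun x => ?_
  rcases eq_or_ne x 0 with rfl | hx
  · simp
  have h1 := h ((‖x‖⁻¹ : ℂ) • x) (norm_smul_inv_norm hx)
  have h2 : ⟪x, T x⟫_ℂ = ((‖x‖ ^ 2 : ℝ) : ℂ) *
      ⟪(‖x‖⁻¹ : ℂ) • x, T ((‖x‖⁻¹ : ℂ) • x)⟫_ℂ := by
    have : (‖x‖ : ℂ) ≠ 0 := by simpa using hx
    simp only [map_smul, inner_smul_left, inner_smul_right, map_inv₀, Complex.conj_ofReal]
    push_cast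
    field_simp
  rw [h2]
  exact mul_nonneg (by exact_mod_cast sq_nonneg ‖x‖) h1

/-- A sequence of uniformly bounded operators has a weak limit along any ultrafilter. -/
theorem exists_weak_limit {ι : Type*} (u : Ultrafilter ι) (T : ι → H →L[ℂ] H) (C : ℝ)
    (hT : ∀ i, ‖T i‖ ≤ C) :
    ∃ L : H →L[ℂ] H, ∀ x y : H, Tendsto (fun i => ⟪x, T i y⟫_ℂ) u (𝓝 ⟪x, L y⟫_ℂ) := by
  have bound : ∀ x y i, ‖⟪T i x, y⟫_ℂ‖ ≤ C * ‖x‖ * ‖y‖ := fun x y i =>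
    (norm_inner_le_norm _ _).trans <| mul_le_mul_of_nonneg_right
      ((T i).le_of_opNorm_le (hT i) x) (norm_nonneg y)
  have lim : ∀ x y, ∃ z, ‖z‖ ≤ C * ‖x‖ * ‖y‖ ∧ Tendsto (fun i => ⟪T i x, y⟫_ℂ) u (𝓝 z) := by
    intro x y
    -- Every matrix coefficient stays in a compact disc, so it converges along the ultrafilter.
    -- Uniqueness of limits then makes the limit sesquilinear, and the same bound lets it be
    -- represented by an operator.
    obtain ⟨z, hz, hz'⟩ := (isCompact_closedBall (0 : ℂ) (C * ‖x‖ * ‖y‖)).ultrafilter_le_nhds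
      (u.map fun i => ⟪T i x, y⟫_ℂ) (by
        rw [le_principal_iff]
        exact Filter.mem_map.2 (Filter.Eventually.of_forall fun i => by simpa using bound x y i))
    exact ⟨z, by simpa using hz, hz'⟩
  choose B hB hB' using lim
  let B' : H →L⋆[ℂ] H →L[ℂ] ℂ := LinearMap.mkContinuous₂
    (LinearMap.mk₂'ₛₗ (starRingEnd ℂ) (RingHom.id ℂ) B
      (fun x x' y => tendsto_nhds_unique (hB' (x + x') y)
        (by simpa [inner_add_left] using (hB' x y).add (hB' x' y)))
      (fun c x y => tendsto_nhds_unique (hB' (c • x) y)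
        (by simpa [inner_smul_left, mul_comm] using (hB' x y).const_mul (starRingEnd ℂ c)))
      (fun x y y' => tendsto_nhds_unique (hB' x (y + y'))
        (by simpa [inner_add_right] using (hB' x y).add (hB' x y')))
      (fun c x y => tendsto_nhds_unique (hB' x (c • y))
        (by simpa [inner_smul_right] using (hB' x y).const_mul c))) C hB
  refine ⟨InnerProductSpace.continuousLinearMapOfBilin B', fun x y => ?_⟩
  have h := (hB' y x).star
  have h2 : ⟪InnerProductSpace.continuousLinearMapOfBilin B' y, x⟫_ℂ = B y x :=
    InnerProductSpace.continuousLinearMapOfBilin_apply B' y x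
  rw [← inner_conj_symm, h2]
  refine h.congr fun i => ?_
  exact inner_conj_symm _ _

end Operators

/-! ### Algebra and positivity of tensor products of operators -/

section OpTensor

variable {H₁ : Type*} [NormedAddCommGroup H₁] [InnerProductSpace ℂ H₁]
  {H₂ : Type*} [NormedAddCommGroup H₂] [InnerProductSpace ℂ H₂]

theorem ext_coe {A B : HilbertTensor H₁ H₂ →L[ℂ] HilbertTensor H₁ H₂}
    (h : ∀ x : H₁ ⊗[ℂ] H₂, A (x : HilbertTensor H₁ H₂) = B (x : HilbertTensor H₁ H₂)) :
    A = B := by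
  ext x
  induction x using UniformSpace.Completion.induction_on with
  | hp => exact isClosed_eq (ContinuousLinearMap.continuous _) (ContinuousLinearMap.continuous _)
  | ih x => exact h x

theorem opTensor_one : opTensor (1 : H₁ →L[ℂ] H₁) (1 : H₂ →L[ℂ] H₂) = 1 :=
  ext_coe fun x => by
    rw [opTensor_coe]
    exact congrArg _ (congrArg (fun f : H₁ ⊗[ℂ] H₂ →ₗ[ℂ] H₁ ⊗[ℂ] H₂ => f x) TensorProduct.map_id)

theorem opTensor_mul (A A' : H₁ →L[ℂ] H₁) (B B' : H₂ →L[ℂ] H₂) :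
    opTensor (A * A') (B * B') = opTensor A B * opTensor A' B' :=
  ext_coe fun x => by
    rw [mul_apply_eq_comp, opTensor_coe, opTensor_coe, opTensor_coe]
    refine congrArg _ ?_
    induction x with
    | zero => simp
    | tmul a b => simp
    | add x y hx hy => rw [map_add, map_add, map_add, hx, hy]

theorem opTensor_add_left (A A' : H₁ →L[ℂ] H₁) (B : H₂ →L[ℂ] H₂) :
    opTensor (A + A') B = opTensor A B + opTensor A' B :=
  ext_coe fun x => by
    rw [add_apply, opTensor_coe, opTensor_coe, opTensor_coe,
      ← UniformSpace.Completion.coe_add]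
    simp [TensorProduct.map_add_left]

theorem opTensor_zero_left (B : H₂ →L[ℂ] H₂) : opTensor (0 : H₁ →L[ℂ] H₁) B = 0 := by
  simpa using opTensor_add_left (0 : H₁ →L[ℂ] H₁) 0 B

theorem opTensor_sum_left {ι : Type*} (s : Finset ι) (A : ι → H₁ →L[ℂ] H₁) (B : H₂ →L[ℂ] H₂) :
    opTensor (∑ i ∈ s, A i) B = ∑ i ∈ s, opTensor (A i) B := by
  classical
  induction s using Finset.induction_on with
  | empty => simp [opTensor_zero_left]
  | insert i s hi ih => rw [Finset.sum_insert hi, Finset.sum_insert hi, opTensor_add_left, ih]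

theorem opTensor_add_right (A : H₁ →L[ℂ] H₁) (B B' : H₂ →L[ℂ] H₂) :
    opTensor A (B + B') = opTensor A B + opTensor A B' :=
  ext_coe fun x => by
    rw [add_apply, opTensor_coe, opTensor_coe, opTensor_coe,
      ← UniformSpace.Completion.coe_add]
    simp [TensorProduct.map_add_right]

theorem inner_opTensor_tmul (A : H₁ →L[ℂ] H₁) (B : H₂ →L[ℂ] H₂) (ξ : H₁) (η : H₂) :
    ⟪((ξ ⊗ₜ[ℂ] η : H₁ ⊗[ℂ] H₂) : HilbertTensor H₁ H₂),
      opTensor A B ((ξ ⊗ₜ[ℂ] η : H₁ ⊗[ℂ] H₂) : HilbertTensor H₁ H₂)⟫_ℂ =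
      ⟪ξ, A ξ⟫_ℂ * ⟪η, B η⟫_ℂ := by
  rw [opTensor_coe]
  simp

variable [CompleteSpace H₁] [CompleteSpace H₂]

theorem inner_map_star_left (A : H₁ →L[ℂ] H₁) (B : H₂ →L[ℂ] H₂) (x y : H₁ ⊗[ℂ] H₂) :
    ⟪TensorProduct.map (star A).toLinearMap (star B).toLinearMap x, y⟫_ℂ =
      ⟪x, TensorProduct.map A.toLinearMap B.toLinearMap y⟫_ℂ := by
  induction x with
  | zero => simp
  | add x x' hx hx' => rw [map_add, inner_add_left, inner_add_left, hx, hx']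
  | tmul a b =>
    induction y with
    | zero => simp
    | add y y' hy hy' => rw [map_add, inner_add_right, inner_add_right, hy, hy']
    | tmul a' b' =>
      simp [ContinuousLinearMap.star_eq_adjoint, ContinuousLinearMap.adjoint_inner_left]

theorem star_opTensor (A : H₁ →L[ℂ] H₁) (B : H₂ →L[ℂ] H₂) :
    star (opTensor A B) = opTensor (star A) (star B) := by
  rw [ContinuousLinearMap.star_eq_adjoint]
  symm
  rw [ContinuousLinearMap.eq_adjoint_iff]
  intro x y
  induction x using UniformSpace.Completion.induction_on with
  | hp => exact isClosed_eq (by fun_prop) (by fun_prop)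
  | ih x =>
    induction y using UniformSpace.Completion.induction_on with
    | hp => exact isClosed_eq (by fun_prop) (by fun_prop)
    | ih y =>
      rw [opTensor_coe, opTensor_coe, UniformSpace.Completion.inner_coe,
        UniformSpace.Completion.inner_coe, inner_map_star_left]

/-- With A = a*a and B = b*b, the tensor product is (a ⊗ b)*(a ⊗ b). -/
theorem opTensor_nonneg {A : H₁ →L[ℂ] H₁} {B : H₂ →L[ℂ] H₂} (hA : 0 ≤ A) (hB : 0 ≤ B) :
    0 ≤ opTensor A B := by
  obtain ⟨a, rfl⟩ := CStarAlgebra.nonneg_iff_eq_star_mul_self.1 hA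
  obtain ⟨b, rfl⟩ := CStarAlgebra.nonneg_iff_eq_star_mul_self.1 hB
  rw [opTensor_mul, ← star_opTensor]
  exact star_mul_self_nonneg (opTensor a b)

end OpTensor

/-! ### Effects of a POVM, recovered from its distributions in pure states -/

section Effects

variable {S : Type*} [MeasurableSpace S]
  {H : Type*} [NormedAddCommGroup H] [InnerProductSpace ℂ H] [CompleteSpace H]

/-- The Born rule for a vector state; together with `eq_of_inner_unit` it turns identities between
measures into identities between effects. -/
theorem POVM.inner_effect (E : POVM S H) {ω : PureState H} {ξ : H}
    (h : ω.op = InnerProductSpace.rankOne ℂ ξ ξ) {X : Set S} (hX : MeasurableSet X) :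
    ⟪ξ, E.effect X ξ⟫_ℂ = (((E.distribution ω.toState : Measure S).real X : ℝ) : ℂ) := by
  rw [← trace_rankOne_mul, ← h]
  exact (E.distribution_spec ω.toState X hX).symm

theorem POVM.effect_nonneg (E : POVM S H) {X : Set S} (hX : MeasurableSet X) :
    0 ≤ E.effect X :=
  nonneg_of_inner_unit fun ξ hξ => by
    rw [E.inner_effect (ω := .ofUnit ξ hξ) rfl hX]
    exact_mod_cast measureReal_nonneg

theorem POVM.effect_univ (E : POVM S H) : E.effect Set.univ = 1 :=
  eq_of_inner_unit fun ξ hξ => by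
    rw [E.inner_effect (ω := .ofUnit ξ hξ) rfl .univ]
    simp [inner_self_eq_norm_sq_to_K, hξ]

theorem POVM.effect_union (E : POVM S H) {X Y : Set S} (hX : MeasurableSet X)
    (hY : MeasurableSet Y) (h : Disjoint X Y) :
    E.effect (X ∪ Y) = E.effect X + E.effect Y :=
  eq_of_inner_unit fun ξ hξ => by
    simp only [add_apply, inner_add_right]
    rw [E.inner_effect (ω := .ofUnit ξ hξ) rfl hX, E.inner_effect (ω := .ofUnit ξ hξ) rfl hY,
      E.inner_effect (ω := .ofUnit ξ hξ) rfl (hX.union hY), measureReal_union h hY]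
    push_cast
    rfl

theorem POVM.effect_compl (E : POVM S H) {X : Set S} (hX : MeasurableSet X) :
    E.effect Xᶜ = 1 - E.effect X := by
  rw [eq_sub_iff_add_eq', ← E.effect_union hX hX.compl disjoint_compl_right, Set.union_compl_self,
    E.effect_univ]

theorem POVM.effect_le_one (E : POVM S H) {X : Set S} (hX : MeasurableSet X) :
    E.effect X ≤ 1 := by
  rw [← sub_nonneg, ← E.effect_compl hX]
  exact E.effect_nonneg hX.compl

theorem POVM.sum_effect_fiber (E : POVM S H) {ι : Type*} (s : SimpleFunc S ι) :
    ∑ y ∈ s.range, E.effect (s ⁻¹' {y}) = 1 :=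
  eq_of_inner_unit fun ξ hξ => by
    rw [sum_apply, inner_sum]
    simp only [E.inner_effect (ω := .ofUnit ξ hξ) rfl (s.measurableSet_fiber _)]
    have := s.sum_range_measure_preimage_singleton
      (E.distribution (PureState.ofUnit ξ hξ).toState : Measure S)
    rw [← Complex.ofReal_sum]
    simp only [measureReal_def]
    rw [← ENNReal.toReal_sum (fun _ _ => measure_ne_top _ _), this]
    simp [inner_self_eq_norm_sq_to_K, hξ]

end Effects

/-! ### Existence of the operator-valued tensor integral -/

section TensorIntegral

theorem integral_comp_simpleFunc {S ι V : Type*} [MeasurableSpace S] [NormedAddCommGroup V]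
    [NormedSpace ℝ V] [CompleteSpace V] (μ : Measure S) [IsFiniteMeasure μ] (s : SimpleFunc S ι)
    (φ : ι → V) : ∫ x, φ (s x) ∂μ = ∑ y ∈ s.range, μ.real (s ⁻¹' {y}) • φ y := by
  classical
  have h : ∀ x, φ (s x) = ∑ y ∈ s.range, (s ⁻¹' {y}).indicator (fun _ => φ y) x := fun x => by
    rw [Finset.sum_eq_single_of_mem (s x) (s.mem_range_self x)]
    · simp
    · intro y _ hy
      simp [hy.symm]
  simp only [h]
  rw [integral_finsetSum _ fun y _ =>
    (integrable_const (φ y)).indicator (s.measurableSet_fiber y)]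
  exact Finset.sum_congr rfl fun y _ => integral_indicator_const _ (s.measurableSet_fiber y)

variable {H₁ : Type*} [NormedAddCommGroup H₁] [InnerProductSpace ℂ H₁] [CompleteSpace H₁]
  {H₂ : Type*} [NormedAddCommGroup H₂] [InnerProductSpace ℂ H₂] [CompleteSpace H₂]
  {S : Type*} [MeasurableSpace S]

/-- The integral `∫ dE(x) ⊗ F(s(x))` for a simple function `s`. -/
def simpleTensorIntegral {ι : Type*} (E : POVM S H₁) (F : ι → H₂ →L[ℂ] H₂) (s : SimpleFunc S ι) :
    HilbertTensor H₁ H₂ →L[ℂ] HilbertTensor H₁ H₂ :=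
  ∑ y ∈ s.range, opTensor (E.effect (s ⁻¹' {y})) (F y)

theorem simpleTensorIntegral_nonneg {ι : Type*} (E : POVM S H₁) {F : ι → H₂ →L[ℂ] H₂}
    (hF : ∀ i, 0 ≤ F i) (s : SimpleFunc S ι) : 0 ≤ simpleTensorIntegral E F s :=
  Finset.sum_nonneg fun y _ => opTensor_nonneg (E.effect_nonneg (s.measurableSet_fiber y)) (hF y)

/-- The fibers partition the space, so 1 is the sum of E(fiber) ⊗ 1, and each summand exceeds
E(fiber) ⊗ F by the positive operator E(fiber) ⊗ (1 - F). -/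
theorem simpleTensorIntegral_le_one {ι : Type*} (E : POVM S H₁) {F : ι → H₂ →L[ℂ] H₂}
    (hF : ∀ i, F i ≤ 1) (s : SimpleFunc S ι) : simpleTensorIntegral E F s ≤ 1 := by
  rw [← opTensor_one, ← E.sum_effect_fiber s, opTensor_sum_left]
  refine Finset.sum_le_sum fun y _ => ?_
  have h := opTensor_add_right (E.effect (s ⁻¹' {y})) (F y) (1 - F y)
  rw [add_sub_cancel] at h
  rw [h]
  exact le_add_of_nonneg_right
    (opTensor_nonneg (E.effect_nonneg (s.measurableSet_fiber y)) (sub_nonneg.2 (hF y)))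

omit [CompleteSpace H₂] in
theorem inner_simpleTensorIntegral {ι : Type*} (E : POVM S H₁) (F : ι → H₂ →L[ℂ] H₂)
    (s : SimpleFunc S ι) {ω : PureState H₁} {ξ : H₁}
    (hω : ω.op = InnerProductSpace.rankOne ℂ ξ ξ) (η : H₂) :
    ⟪((ξ ⊗ₜ[ℂ] η : H₁ ⊗[ℂ] H₂) : HilbertTensor H₁ H₂),
      simpleTensorIntegral E F s ((ξ ⊗ₜ[ℂ] η : H₁ ⊗[ℂ] H₂) : HilbertTensor H₁ H₂)⟫_ℂ =
      ∫ x, ⟪η, F (s x) η⟫_ℂ ∂(E.distribution ω.toState : Measure S) := by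
  rw [integral_comp_simpleFunc _ s fun y => ⟪η, F y η⟫_ℂ, simpleTensorIntegral, sum_apply,
    inner_sum]
  refine Finset.sum_congr rfl fun y _ => ?_
  rw [inner_opTensor_tmul, E.inner_effect hω (s.measurableSet_fiber y), Complex.real_smul]

theorem isTensorIntegral_iff {E : POVM S H₁} {F : S → H₂ →L[ℂ] H₂}
    {T : HilbertTensor H₁ H₂ →L[ℂ] HilbertTensor H₁ H₂} :
    IsTensorIntegral E F T ↔ ∀ (ξ : H₁) (hξ : ‖ξ‖ = 1) (η : H₂), ‖η‖ = 1 →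
      ⟪((ξ ⊗ₜ[ℂ] η : H₁ ⊗[ℂ] H₂) : HilbertTensor H₁ H₂),
        T ((ξ ⊗ₜ[ℂ] η : H₁ ⊗[ℂ] H₂) : HilbertTensor H₁ H₂)⟫_ℂ =
      ∫ x, ⟪η, F x η⟫_ℂ ∂(E.distribution (PureState.ofUnit ξ hξ).toState : Measure S) := by
  constructor
  · intro h ξ hξ η hη
    have := h (.ofUnit ξ hξ) (.ofUnit η hη)
    simpa only [PureState.tensor, PureState.ofUnit, opTensor_rankOne, trace_rankOne_mul] using this
  · rintro h ⟨_, ξ, hξ, rfl⟩ ⟨_, η, hη, rfl⟩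
    simpa only [PureState.tensor, PureState.ofUnit, opTensor_rankOne, trace_rankOne_mul] using
      h ξ hξ η hη

/-- Simple functions s_n → id give operators between 0 and 1, which have a weak limit along an
ultrafilter. On product vectors dominated convergence evaluates the limit, because F is continuous
in quadratic form. -/
theorem exists_isTensorIntegral [TopologicalSpace S] [TopologicalSpace.PseudoMetrizableSpace S]
    [SecondCountableTopology S] [BorelSpace S] [Nonempty S]
    (E : POVM S H₁) {F : S → H₂ →L[ℂ] H₂} (hc : ∀ η, Continuous fun x => ⟪η, F x η⟫_ℂ)
    (h0 : ∀ x, 0 ≤ F x) (h1 : ∀ x, F x ≤ 1) :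
    ∃ T, 0 ≤ T ∧ IsTensorIntegral E F T := by
  let := TopologicalSpace.pseudoMetrizableSpacePseudoMetric S
  obtain ⟨y₀⟩ := ‹Nonempty S›
  let s : ℕ → SimpleFunc S S :=
    SimpleFunc.approxOn id measurable_id Set.univ y₀ (Set.mem_univ _)
  have hs : ∀ x, Tendsto (fun n => s n x) atTop (𝓝 x) := fun x =>
    SimpleFunc.tendsto_approxOn measurable_id (Set.mem_univ _) (by simp)
  have hn : ∀ n, 0 ≤ simpleTensorIntegral E F (s n) := fun n => simpleTensorIntegral_nonneg E h0 _
  obtain ⟨T, hT⟩ := exists_weak_limit (hyperfilter ℕ) (fun n => simpleTensorIntegral E F (s n)) 1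
    fun n => (CStarAlgebra.norm_le_one_iff_of_nonneg _ (hn n)).2 (simpleTensorIntegral_le_one E h1 _)
  refine ⟨T, nonneg_iff_inner.2 fun x => ?_, isTensorIntegral_iff.2 fun ξ hξ η hη => ?_⟩
  · exact ge_of_tendsto (hT x x) (.of_forall fun n => nonneg_iff_inner.1 (hn n) x)
  -- On product vectors the sequence converges in the ordinary sense, so its ultrafilter limit must
  -- be the same number.
  · refine tendsto_nhds_unique (hT _ _) (Tendsto.mono_left ?_ Nat.hyperfilter_le_atTop)
    simp only [inner_simpleTensorIntegral E F _ (ω := .ofUnit ξ hξ) rfl]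
    refine tendsto_integral_of_dominated_convergence (fun _ => 1) (fun n => ?_)
      (integrable_const _) (fun n => .of_forall fun x => ?_) (.of_forall fun x => ?_)
    · exact ((hc η).measurable.comp (s n).measurable).aestronglyMeasurable
    · refine (norm_inner_le_norm _ _).trans ?_
      have := (F (s n x)).le_of_opNorm_le
        ((CStarAlgebra.norm_le_one_iff_of_nonneg _ (h0 _)).2 (h1 _)) η
      simpa [hη] using this
    · exact ((hc η).tendsto x).comp (hs x)

end TensorIntegral

/-! ### From product vectors to all vectors of the Hilbert tensor product -/

section Integration

variable {H : Type*} [NormedAddCommGroup H] [InnerProductSpace ℂ H] [CompleteSpace H]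

omit [CompleteSpace H] in
/-- The quadratic form of a positive operator satisfies `q (x + y) ≤ 2 q x + 2 q y`. -/
theorem re_inner_add_le {T : H →L[ℂ] H} (hT : 0 ≤ T) (x y : H) :
    (⟪x + y, T (x + y)⟫_ℂ).re ≤ 2 * (⟪x, T x⟫_ℂ).re + 2 * (⟪y, T y⟫_ℂ).re := by
  -- Parallelogram law: q(x + y) + q(x - y) = 2 q(x) + 2 q(y), and q(x - y) ≥ 0.
  have h := re_inner_nonneg hT (x - y)
  simp only [map_add, map_sub, inner_add_left, inner_add_right, inner_sub_left, inner_sub_right,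
    Complex.add_re, Complex.sub_re] at h ⊢
  linarith

/-- For contractions `0 ≤ D n ≤ 1`, weak convergence `D n → 0` may be checked on product vectors. -/
theorem tendsto_inner_zero_of_tmul {H₁ H₂ : Type*} [NormedAddCommGroup H₁]
    [InnerProductSpace ℂ H₁] [NormedAddCommGroup H₂] [InnerProductSpace ℂ H₂]
    {D : ℕ → HilbertTensor H₁ H₂ →L[ℂ] HilbertTensor H₁ H₂} (h0 : ∀ n, 0 ≤ D n)
    (h1 : ∀ n, D n ≤ 1)
    (h : ∀ (ξ : H₁) (η : H₂), ‖ξ‖ = 1 → ‖η‖ = 1 → Tendsto (fun n =>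
      (⟪((ξ ⊗ₜ[ℂ] η : H₁ ⊗[ℂ] H₂) : HilbertTensor H₁ H₂),
        D n ((ξ ⊗ₜ[ℂ] η : H₁ ⊗[ℂ] H₂) : HilbertTensor H₁ H₂)⟫_ℂ).re) atTop (𝓝 0))
    (z : HilbertTensor H₁ H₂) : Tendsto (fun n => (⟪z, D n z⟫_ℂ).re) atTop (𝓝 0) := by
  have c0 : ((0 : H₁ ⊗[ℂ] H₂) : HilbertTensor H₁ H₂) = 0 := UniformSpace.Completion.coe_zero
  have tm : ∀ (ξ : H₁) (η : H₂), Tendsto (fun n =>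
      (⟪((ξ ⊗ₜ[ℂ] η : H₁ ⊗[ℂ] H₂) : HilbertTensor H₁ H₂),
        D n ((ξ ⊗ₜ[ℂ] η : H₁ ⊗[ℂ] H₂) : HilbertTensor H₁ H₂)⟫_ℂ).re) atTop (𝓝 0) := by
    intro ξ η
    rcases eq_or_ne ξ 0 with rfl | hξ
    · simp [c0]
    rcases eq_or_ne η 0 with rfl | hη
    · simp [c0]
    have hu := (h ((‖ξ‖⁻¹ : ℂ) • ξ) ((‖η‖⁻¹ : ℂ) • η) (norm_smul_inv_norm hξ)
      (norm_smul_inv_norm hη)).const_mul (‖ξ‖ ^ 2 * ‖η‖ ^ 2)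
    rw [mul_zero] at hu
    refine hu.congr fun n => ?_
    have hξ' : ‖ξ‖ ≠ 0 := by simpa using hξ
    have hη' : ‖η‖ ≠ 0 := by simpa using hη
    simp only [← TensorProduct.smul_tmul', TensorProduct.tmul_smul,
      UniformSpace.Completion.coe_smul, map_smul, inner_smul_left, inner_smul_right,
      Complex.conj_ofReal, ← Complex.ofReal_inv, Complex.re_ofReal_mul]
    field_simp
  have alg : ∀ x : H₁ ⊗[ℂ] H₂, Tendsto (fun n =>
      (⟪(x : HilbertTensor H₁ H₂), D n (x : HilbertTensor H₁ H₂)⟫_ℂ).re) atTop (𝓝 0) := by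
    intro x
    induction x with
    | zero => simp [c0]
    | tmul a b => exact tm a b
    | add x y hx hy =>
      refine squeeze_zero (fun n => re_inner_nonneg (h0 n) _) (fun n => ?_)
        (by simpa using (hx.const_mul 2).add (hy.const_mul 2))
      rw [UniformSpace.Completion.coe_add]
      exact re_inner_add_le (h0 n) _ _
  rw [Metric.tendsto_atTop]
  intro ε hε
  -- Split z = x + (z - x) with x algebraic: the form at z is below 2 · ε/4 + 2 · ε/8 < ε, where D n
  -- ≤ 1 bounds the second term uniformly in n.
  have hδ : 0 < Real.sqrt (ε / 8) := Real.sqrt_pos.2 (by positivity)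
  obtain ⟨x, hx⟩ := UniformSpace.Completion.denseRange_coe.exists_dist_lt z hδ
  obtain ⟨N, hN⟩ := Metric.tendsto_atTop.1 (alg x) (ε / 4) (by positivity)
  refine ⟨N, fun n hn => ?_⟩
  have e1 := hN n hn
  have e2 := re_inner_add_le (h0 n) (x : HilbertTensor H₁ H₂) (z - x)
  have e3 := re_inner_le_norm_sq (h1 n) (z - x)
  rw [dist_eq_norm] at hx
  have e4 : ‖z - x‖ ^ 2 ≤ ε / 8 := by
    rw [← Real.sq_sqrt (show 0 ≤ ε / 8 by positivity)]
    exact pow_le_pow_left₀ (norm_nonneg _) hx.le 2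
  rw [add_sub_cancel] at e2
  rw [Real.dist_eq, sub_zero, abs_of_nonneg (re_inner_nonneg (h0 n) _)] at e1 ⊢
  linarith

end Integration

/-! ### Density operators as mixtures of vector states -/

section Trace

variable {H : Type*} [NormedAddCommGroup H] [InnerProductSpace ℂ H] [CompleteSpace H]

omit [CompleteSpace H] in
theorem hasSum_norm_inner_sq {ι : Type*} (b : HilbertBasis ι ℂ H) (x : H) :
    HasSum (fun i => ‖⟪b i, x⟫_ℂ‖ ^ 2) (‖x‖ ^ 2) := by
  have h := b.hasSum_inner_mul_inner x x
  have h2 : ∀ i, ⟪x, b i⟫_ℂ * ⟪b i, x⟫_ℂ = ((‖⟪b i, x⟫_ℂ‖ ^ 2 : ℝ) : ℂ) := fun i => by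
    rw [← inner_conj_symm, Complex.conj_mul']
    push_cast
    rfl
  have h3 : ⟪x, x⟫_ℂ = ((‖x‖ ^ 2 : ℝ) : ℂ) := by
    rw [inner_self_eq_norm_sq_to_K]
    push_cast
    rfl
  simp only [h2, h3] at h
  exact Complex.hasSum_ofReal.1 h

/-- `tr (S S T) = tr (S T S)` for a self-adjoint Hilbert-Schmidt operator `S`. -/
theorem tsum_inner_sq_mul {ι : Type*} (b : HilbertBasis ι ℂ H) {S : H →L[ℂ] H}
    (hS : IsSelfAdjoint S) (hs : Summable fun i => ‖S (b i)‖ ^ 2) (T : H →L[ℂ] H) :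
    ∑' i, ⟪b i, (S * S * T) (b i)⟫_ℂ = ∑' j, ⟪S (b j), T (S (b j))⟫_ℂ := by
  have sym : ∀ x y : H, ⟪S x, y⟫_ℂ = ⟪x, S y⟫_ℂ := fun x y => by
    rw [← ContinuousLinearMap.adjoint_inner_right, ← ContinuousLinearMap.star_eq_adjoint,
      hS.star_eq]
  -- By Parseval the two sides are the row sums and the column sums of this one array. It is
  -- absolutely summable because each entry is a product of matrix entries of the Hilbert-Schmidt
  -- operators T*S and S.
  let f : ι → ι → ℂ := fun j i => ⟪T.adjoint (S (b j)), b i⟫_ℂ * ⟪b i, S (b j)⟫_ℂ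
  have row : ∀ j, HasSum (f j) ⟪S (b j), T (S (b j))⟫_ℂ := fun j => by
    rw [← ContinuousLinearMap.adjoint_inner_left]
    exact b.hasSum_inner_mul_inner _ _
  have col : ∀ i, HasSum (fun j => f j i) ⟪b i, (S * S * T) (b i)⟫_ℂ := fun i => by
    have h : ⟪b i, (S * S * T) (b i)⟫_ℂ = ⟪S (b i), S (T (b i))⟫_ℂ := by
      rw [sym]
      rfl
    rw [h]
    refine (b.hasSum_inner_mul_inner (S (b i)) (S (T (b i)))).congr_fun fun j => ?_
    simp only [f]
    rw [ContinuousLinearMap.adjoint_inner_left, sym, sym, mul_comm]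
  have sq : ∀ v : ι → H, (Summable fun j => ‖v j‖ ^ 2) →
      Summable fun p : ι × ι => ‖⟪b p.2, v p.1⟫_ℂ‖ ^ 2 := fun v hv => by
    refine (summable_prod_of_nonneg fun p => by positivity).2
      ⟨fun j => (hasSum_norm_inner_sq b (v j)).summable, ?_⟩
    simpa only [(hasSum_norm_inner_sq b _).tsum_eq] using hv
  have sT : Summable fun j => ‖T.adjoint (S (b j))‖ ^ 2 := by
    refine (hs.mul_left (‖T.adjoint‖ ^ 2)).of_nonneg_of_le (fun j => by positivity) fun j => ?_
    rw [← mul_pow]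
    exact pow_le_pow_left₀ (norm_nonneg _) (T.adjoint.le_opNorm _) 2
  have summ : Summable (Function.uncurry f) := by
    refine Summable.of_norm_bounded ((sq _ sT).add (sq _ hs)) fun p => ?_
    simp only [Function.uncurry, f, norm_mul]
    rw [norm_inner_symm]
    nlinarith [sq_nonneg (‖⟪b p.2, T.adjoint (S (b p.1))⟫_ℂ‖ - ‖⟪b p.2, S (b p.1)⟫_ℂ‖),
      sq_nonneg ‖⟪b p.2, T.adjoint (S (b p.1))⟫_ℂ‖, sq_nonneg ‖⟪b p.2, S (b p.1)⟫_ℂ‖]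
  simp only [← (row _).tsum_eq, ← (col _).tsum_eq]
  exact summ.tsum_comm

/-- A density operator is a countable mixture of vector states. -/
theorem State.exists_vectors (W : State H) :
    ∃ (w : Set H) (v : w → H), HasSum (fun i => ‖v i‖ ^ 2) 1 ∧
      ∀ T : H →L[ℂ] H, trace (W.op * T) = ∑' i, ⟪v i, T (v i)⟫_ℂ := by
  let b := (exists_hilbertBasis ℂ H).choose_spec.choose
  have h0 : 0 ≤ W.op := (ContinuousLinearMap.nonneg_iff_isPositive _).2 W.isPositive
  -- The mixture consists of the vectors S bᵢ, with S the positive square root of the density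
  -- operator.
  let S := CFC.sqrt W.op
  have hS : IsSelfAdjoint S := (CFC.sqrt_nonneg W.op).isSelfAdjoint
  have hW : W.op = S * S := (CFC.sqrt_mul_sqrt_self W.op h0).symm
  have hd : ∀ i, ⟪b i, W.op (b i)⟫_ℂ = ((‖S (b i)‖ ^ 2 : ℝ) : ℂ) := fun i => by
    rw [hW, mul_apply_eq_comp, ← ContinuousLinearMap.adjoint_inner_left,
      ← ContinuousLinearMap.star_eq_adjoint, hS.star_eq, inner_self_eq_norm_sq_to_K]
    push_cast
    rfl
  have ht : ∑' i, ((‖S (b i)‖ ^ 2 : ℝ) : ℂ) = 1 := by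
    rw [← W.trace_op]
    exact tsum_congr fun i => (hd i).symm
  rw [← Complex.ofReal_tsum] at ht
  have ht' : ∑' i, ‖S (b i)‖ ^ 2 = 1 := by exact_mod_cast ht
  -- A divergent series would have the default sum 0, contradicting trace one.
  have hs : Summable fun i => ‖S (b i)‖ ^ 2 := by
    by_contra h
    rw [tsum_eq_zero_of_not_summable h] at ht'
    exact zero_ne_one ht'
  refine ⟨_, fun i => S (b i), ht' ▸ hs.hasSum, fun T => ?_⟩
  rw [hW]
  exact tsum_inner_sq_mul b hS hs T

end Trace

/-! ### Building a POVM from its distributions in product states -/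

section Observables

variable {S : Type*} [MeasurableSpace S]
  {H : Type*} [NormedAddCommGroup H] [InnerProductSpace ℂ H] [CompleteSpace H]

/-- Operators whose quadratic forms are measures, and with total effect `1`, have a probability
distribution in every state. -/
theorem exists_distribution_of_measure {E : Set S → H →L[ℂ] H}
    (h0 : ∀ X, MeasurableSet X → 0 ≤ E X) (h1 : ∀ X, MeasurableSet X → E X ≤ 1)
    (hu : E Set.univ = 1)
    (h : ∀ x : H, ∃ ν : Measure S, ∀ X, MeasurableSet X → ν X = ENNReal.ofReal (⟪x, E X x⟫_ℂ).re)
    (ω : State H) : ∃ μ : ProbabilityMeasure S, HasDistribution E ω μ := by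
  choose ν hν using h
  obtain ⟨w, v, hv, ht⟩ := ω.exists_vectors
  -- The required distribution is the sum of the measures of the vectors in the mixture; the total
  -- weight 1 makes it a probability measure.
  have hs : ∀ X, MeasurableSet X → Summable fun i => (⟪v i, E X (v i)⟫_ℂ).re := fun X hX =>
    hv.summable.of_nonneg_of_le (fun i => re_inner_nonneg (h0 X hX) _)
      fun i => re_inner_le_norm_sq (h1 X hX) _
  have hm : ∀ X, MeasurableSet X → Measure.sum (fun i => ν (v i)) X =
      ENNReal.ofReal (∑' i, (⟪v i, E X (v i)⟫_ℂ).re) := fun X hX => by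
    rw [Measure.sum_apply _ hX, ENNReal.ofReal_tsum_of_nonneg
      (fun i => re_inner_nonneg (h0 X hX) _) (hs X hX)]
    exact tsum_congr fun i => hν _ X hX
  have hp : IsProbabilityMeasure (Measure.sum fun i => ν (v i)) := ⟨by
    have h2 : ∀ i, (⟪v i, v i⟫_ℂ).re = ‖v i‖ ^ 2 := fun i => inner_self_eq_norm_sq (𝕜 := ℂ) _
    rw [hm _ .univ, hu]
    simp only [one_apply_eq_self, h2, hv.tsum_eq, ENNReal.ofReal_one]⟩
  refine ⟨⟨_, hp⟩, fun X hX => ?_⟩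
  rw [ht]
  change (((Measure.sum fun i => ν (v i)) X).toReal : ℂ) = _
  rw [hm X hX, ENNReal.toReal_ofReal (tsum_nonneg fun i => re_inner_nonneg (h0 X hX) _),
    Complex.ofReal_tsum]
  refine tsum_congr fun i => ?_
  exact Complex.ext (by simp)
    (by simpa using (Complex.nonneg_iff.1 (nonneg_iff_inner.1 (h0 X hX) (v i))).2)

variable {H₁ : Type*} [NormedAddCommGroup H₁] [InnerProductSpace ℂ H₁] [CompleteSpace H₁]
  {H₂ : Type*} [NormedAddCommGroup H₂] [InnerProductSpace ℂ H₂] [CompleteSpace H₂]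

omit [CompleteSpace H₁] [CompleteSpace H₂] in
theorem trace_tensor_mul {ω : PureState H₁} {ρ : PureState H₂} {ξ : H₁} {η : H₂}
    (hω : ω.op = InnerProductSpace.rankOne ℂ ξ ξ) (hρ : ρ.op = InnerProductSpace.rankOne ℂ η η)
    (T : HilbertTensor H₁ H₂ →L[ℂ] HilbertTensor H₁ H₂) :
    trace ((ω.tensor ρ).op * T) =
      ⟪((ξ ⊗ₜ[ℂ] η : H₁ ⊗[ℂ] H₂) : HilbertTensor H₁ H₂),
        T ((ξ ⊗ₜ[ℂ] η : H₁ ⊗[ℂ] H₂) : HilbertTensor H₁ H₂)⟫_ℂ := by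
  change trace (opTensor ω.op ρ.op * T) = _
  rw [hω, hρ, opTensor_rankOne, trace_rankOne_mul]

omit [CompleteSpace H₁] [CompleteSpace H₂] in
theorem trace_tensor_mul_add (ω : PureState H₁) (ρ : PureState H₂)
    (T T' : HilbertTensor H₁ H₂ →L[ℂ] HilbertTensor H₁ H₂) :
    trace ((ω.tensor ρ).op * (T + T')) =
      trace ((ω.tensor ρ).op * T) + trace ((ω.tensor ρ).op * T') := by
  obtain ⟨ξ, -, hω⟩ := ω.exists_vector
  obtain ⟨η, -, hρ⟩ := ρ.exists_vector
  rw [trace_tensor_mul hω hρ, trace_tensor_mul hω hρ, trace_tensor_mul hω hρ, add_apply,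
    inner_add_right]

omit [CompleteSpace H₁] [CompleteSpace H₂] in
theorem trace_tensor (ω : PureState H₁) (ρ : PureState H₂) :
    trace (ω.tensor ρ).op = 1 :=
  (ω.tensor ρ).toState.trace_op

/-- Positive tensor integrals `T X` whose distribution in every product state is a probability
measure are the effects of a POVM. -/
theorem exists_povm_of_isTensorIntegral {R : Type*} [MeasurableSpace R] (E : POVM R H₁)
    (F : Set S → R → H₂ →L[ℂ] H₂) (T : Set S → HilbertTensor H₁ H₂ →L[ℂ] HilbertTensor H₁ H₂)
    (hT : ∀ X, MeasurableSet X → IsTensorIntegral E (F X) (T X))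
    (h0 : ∀ X, MeasurableSet X → 0 ≤ T X) (κ : PureState H₁ → PureState H₂ → ProbabilityMeasure S)
    (hκ : ∀ ω ρ X, MeasurableSet X →
      trace ((ω.tensor ρ).op * T X) = (((κ ω ρ : Measure S).real X : ℝ) : ℂ)) :
    ∃ E' : POVM S (HilbertTensor H₁ H₂), E'.effect = T := by
  -- Uniqueness of the tensor integral: an operator with the prescribed expectations in all product
  -- states is `T X`. This yields normalization and finite additivity.
  have ext : ∀ X, MeasurableSet X → ∀ A, (∀ ω ρ, trace ((ω.tensor ρ).op * A) =
      (((κ ω ρ : Measure S).real X : ℝ) : ℂ)) → T X = A := fun X hX A hA =>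
    (hT X hX).unique fun ω ρ => by rw [hA, ← hκ ω ρ X hX, hT X hX ω ρ]
  have univ : T Set.univ = 1 := ext _ .univ _ fun ω ρ => by simp [trace_tensor]
  have union : ∀ X Y, MeasurableSet X → MeasurableSet Y → Disjoint X Y →
      T (X ∪ Y) = T X + T Y := fun X Y hX hY h => ext _ (hX.union hY) _ fun ω ρ => by
    rw [trace_tensor_mul_add, hκ ω ρ X hX, hκ ω ρ Y hY, measureReal_union h hY]
    push_cast
    rfl
  have empty : T ∅ = 0 := by simpa using union ∅ ∅ .empty .empty (Set.disjoint_empty _)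
  have diff : ∀ X Y, MeasurableSet X → MeasurableSet Y → Y ⊆ X → T (X \ Y) = T X - T Y :=
    fun X Y hX hY h => by
      rw [eq_sub_iff_add_eq', ← union Y _ hY (hX.diff hY) Set.disjoint_sdiff_right,
        Set.union_sdiff_cancel h]
  have h1 : ∀ X, MeasurableSet X → T X ≤ 1 := fun X hX => by
    rw [← sub_nonneg, ← univ, ← diff _ _ .univ hX (Set.subset_univ X)]
    exact h0 _ (MeasurableSet.univ.diff hX)
  have partialSum : ∀ f : ℕ → Set S, (∀ i, MeasurableSet (f i)) → Pairwise (Function.onFun Disjoint f) →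
      ∀ n, T (⋃ i ∈ Finset.range n, f i) = ∑ i ∈ Finset.range n, T (f i) := by
    intro f hf hd n
    induction n with
    | zero => simpa using empty
    | succ n ih =>
      rw [Finset.sum_range_succ, ← ih, ← union _ _ (Finset.measurableSet_biUnion _ fun i _ => hf i)
        (hf n)]
      · congr 1
        simp only [Finset.range_add_one, Finset.set_biUnion_insert, Set.union_comm]
      · rw [Set.disjoint_iUnion₂_left]
        exact fun i hi => hd (Finset.mem_range.1 hi).ne
  refine ⟨⟨T, exists_distribution_of_measure h0 h1 univ fun x => ?_⟩, rfl⟩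
  have sigma : ∀ f : ℕ → Set S, (∀ i, MeasurableSet (f i)) → Pairwise (Function.onFun Disjoint f) →
      HasSum (fun i => (⟪x, T (f i) x⟫_ℂ).re) (⟪x, T (⋃ i, f i) x⟫_ℂ).re := by
    intro f hf hd
    -- The tails decrease to ∅, so their probabilities in product states tend to 0. Since 0 ≤ T (Y
    -- n) ≤ 1, the same holds for the quadratic form at every vector, which is σ-additivity.
    let Y : ℕ → Set S := fun n => (⋃ i, f i) \ ⋃ i ∈ Finset.range n, f i
    have hU : MeasurableSet (⋃ i, f i) := MeasurableSet.iUnion hf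
    have hP : ∀ n, MeasurableSet (⋃ i ∈ Finset.range n, f i) := fun n =>
      Finset.measurableSet_biUnion _ fun i _ => hf i
    have hY : ∀ n, MeasurableSet (Y n) := fun n => hU.diff (hP n)
    have hanti : Antitone Y := fun m n hmn => Set.sdiff_subset_sdiff_right <|
      Set.biUnion_subset_biUnion_left fun i hi =>
        Finset.mem_coe.2 (Finset.range_subset_range.2 hmn (Finset.mem_coe.1 hi))
    have hY0 : ⋂ n, Y n = ∅ := by
      refine Set.eq_empty_of_forall_notMem fun y hy => ?_
      rw [Set.mem_iInter] at hy
      obtain ⟨i, hi⟩ := Set.mem_iUnion.1 (hy 0).1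
      exact (hy (i + 1)).2 (Set.mem_biUnion (Finset.mem_coe.2 (Finset.self_mem_range_succ i)) hi)
    have lim := tendsto_inner_zero_of_tmul (D := fun n => T (Y n)) (fun n => h0 _ (hY n))
      (fun n => h1 _ (hY n)) (fun ξ η hξ hη => by
        have hm := tendsto_measure_iInter_atTop
          (μ := (κ (.ofUnit ξ hξ) (.ofUnit η hη) : Measure S))
          (fun n => (hY n).nullMeasurableSet) hanti ⟨0, measure_ne_top _ _⟩
        rw [hY0, measure_empty] at hm
        have hm2 := (ENNReal.tendsto_toReal ENNReal.zero_ne_top).comp hm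
        refine hm2.congr fun n => ?_
        have := hκ (.ofUnit ξ hξ) (.ofUnit η hη) _ (hY n)
        rw [trace_tensor_mul rfl rfl] at this
        rw [this, Complex.ofReal_re]
        rfl) x
    rw [hasSum_iff_tendsto_nat_of_nonneg fun i => re_inner_nonneg (h0 _ (hf i)) x]
    have lim2 := lim.const_sub (⟪x, T (⋃ i, f i) x⟫_ℂ).re
    rw [sub_zero] at lim2
    refine lim2.congr fun n => ?_
    have hsub : (⋃ i ∈ Finset.range n, f i) ⊆ ⋃ i, f i :=
      Set.iUnion₂_subset fun i _ => Set.subset_iUnion f i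
    rw [diff _ _ hU (hP n) hsub, partialSum f hf hd, sub_apply, inner_sub_right, sum_apply,
      inner_sum, Complex.sub_re, Complex.re_sum, sub_sub_cancel]
  refine ⟨Measure.ofMeasurable (fun X _ => ENNReal.ofReal (⟪x, T X x⟫_ℂ).re) (by simp [empty])
    fun f hf hd => ?_, fun X hX => Measure.ofMeasurable_apply X hX⟩
  have hs := sigma f hf hd
  rw [← hs.tsum_eq, ENNReal.ofReal_tsum_of_nonneg (fun i => re_inner_nonneg (h0 _ (hf i)) x)
    hs.summable]

end Observables

/-! ### Relative laws, covariance and the double limit -/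

section RelativeOrientation

theorem ProjRep.continuous_inner_act {G H : Type*} [Group G] [TopologicalSpace G]
    [NormedAddCommGroup H] [InnerProductSpace ℂ H] [CompleteSpace H] (V : ProjRep G H)
    (A : H →L[ℂ] H) (η : H) : Continuous fun g => ⟪η, V.act g A η⟫_ℂ := by
  have norm_star : ∀ g x, ‖star (V.U g : H →L[ℂ] H) x‖ = ‖x‖ := fun g x =>
    ContinuousLinearMap.norm_map_of_mem_unitary (Unitary.star_mem (V.U g).2) x
  have star_mul : ∀ g x, star (V.U g : H →L[ℂ] H) ((V.U g : H →L[ℂ] H) x) = x := fun g x => by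
    rw [← mul_apply_eq_comp, Unitary.coe_star_mul_self, one_apply_eq_self]
  have mul_star : ∀ g x, (V.U g : H →L[ℂ] H) (star (V.U g : H →L[ℂ] H) x) = x := fun g x => by
    have := congrArg (fun B : H →L[ℂ] H => B x) (Unitary.mul_star_self_of_mem (V.U g).2)
    exact this
  -- Strong continuity of the adjoints: by unitarity ‖U(g)*η - U(g₀)*η‖ = ‖η - U(g)U(g₀)*η‖, which
  -- tends to 0 as g → g₀.
  have hc : Continuous fun g => star (V.U g : H →L[ℂ] H) η := by
    refine continuous_iff_continuousAt.2 fun g₀ => ?_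
    rw [ContinuousAt, tendsto_iff_norm_sub_tendsto_zero]
    have h := (continuous_const.sub
      (V.strongly_continuous (star (V.U g₀ : H →L[ℂ] H) η))).norm.tendsto (f := fun g =>
        ‖η - (V.U g : H →L[ℂ] H) (star (V.U g₀ : H →L[ℂ] H) η)‖) g₀
    rw [mul_star, sub_self, norm_zero] at h
    refine h.congr fun g => ?_
    rw [← norm_star g, map_sub, star_mul]
  have h2 : ∀ g, ⟪η, V.act g A η⟫_ℂ =
      ⟪star (V.U g : H →L[ℂ] H) η, A (star (V.U g : H →L[ℂ] H) η)⟫_ℂ := fun g => by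
    rw [ContinuousLinearMap.star_eq_adjoint, ContinuousLinearMap.adjoint_inner_left]
    rfl
  simp only [h2]
  fun_prop

variable {G : Type*} [Group G] [TopologicalSpace G] [IsTopologicalGroup G]
  [SecondCountableTopology G] [MeasurableSpace G] [BorelSpace G]
  {H₁ : Type*} [NormedAddCommGroup H₁] [InnerProductSpace ℂ H₁] [CompleteSpace H₁]
  {H₂ : Type*} [NormedAddCommGroup H₂] [InnerProductSpace ℂ H₂] [CompleteSpace H₂]

omit [SecondCountableTopology G] [MeasurableSpace G] [BorelSpace G] in
theorem continuous_inv_mul : Continuous fun p : G × G => p.1⁻¹ * p.2 := by fun_prop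

/-- The law of `g⁻¹ k` for independent `g ∼ μ` and `k ∼ ν`. -/
def relativeLaw (μ ν : ProbabilityMeasure G) : ProbabilityMeasure G :=
  (μ.prod ν).map continuous_inv_mul.measurable.aemeasurable

/-- Products of probability measures are jointly weakly continuous, and so is the pushforward along
the continuous map (g, k) ↦ g⁻¹k. -/
theorem tendsto_relativeLaw [TopologicalSpace.PseudoMetrizableSpace G] {ι : Type*} {l : Filter ι}
    {μ ν : ι → ProbabilityMeasure G} {μ' ν' : ProbabilityMeasure G} (hμ : Tendsto μ l (𝓝 μ'))
    (hν : Tendsto ν l (𝓝 ν')) :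
    Tendsto (fun i => relativeLaw (μ i) (ν i)) l (𝓝 (relativeLaw μ' ν')) :=
  ProbabilityMeasure.tendsto_map_of_tendsto_of_continuous _ _
    ((ProbabilityMeasure.continuous_prod.tendsto (μ', ν')).comp (hμ.prodMk_nhds hν))
    continuous_inv_mul

theorem relativeLaw_diracProba (g h : G) :
    relativeLaw (diracProba g) (diracProba h) = diracProba (g⁻¹ * h) := by
  apply Subtype.ext
  change Measure.map _ ((Measure.dirac g).prod (Measure.dirac h)) = Measure.dirac (g⁻¹ * h)
  rw [Measure.dirac_prod_dirac, Measure.map_dirac' continuous_inv_mul.measurable]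

/-- Fubini: the slice at g of the set where g⁻¹k ∈ X is gX. -/
theorem relativeLaw_real (μ ν : ProbabilityMeasure G) {X : Set G} (hX : MeasurableSet X) :
    (relativeLaw μ ν : Measure G).real X = ∫ g, (ν : Measure G).real (g • X) ∂(μ : Measure G) := by
  have hm : MeasurableSet ((fun p : G × G => p.1⁻¹ * p.2) ⁻¹' X) :=
    continuous_inv_mul.measurable hX
  have h : ∀ g : G, Prod.mk g ⁻¹' ((fun p : G × G => p.1⁻¹ * p.2) ⁻¹' X) = g • X := fun g => by
    ext k
    simp [Set.mem_smul_set_iff_inv_smul_mem]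
  rw [measureReal_def, relativeLaw, ProbabilityMeasure.toMeasure_map,
    Measure.map_apply continuous_inv_mul.measurable hX, ProbabilityMeasure.toMeasure_prod,
    Measure.prod_apply hm]
  have hmm := measurable_measure_prodMk_left (ν := (ν : Measure G)) hm
  simp only [h] at hmm ⊢
  exact (integral_toReal hmm.aemeasurable (.of_forall fun _ => measure_lt_top _ _)).symm

/-- Covariance replaces g.E₂(X) by E₂(gX), so the integrand becomes the probability of gX in the
state `ρ`. -/
theorem trace_relativization {R₁ : Frame G H₁} {R₂ : Frame G H₂} {X : Set G} (hX : MeasurableSet X)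
    {T : HilbertTensor H₁ H₂ →L[ℂ] HilbertTensor H₁ H₂}
    (hT : R₁.IsRelativization R₂.rep (R₂.observable.effect X) T) (ω : PureState H₁)
    (ρ : PureState H₂) :
    trace ((ω.tensor ρ).op * T) = (((relativeLaw (R₁.observable.distribution ω.toState)
      (R₂.observable.distribution ρ.toState) : Measure G).real X : ℝ) : ℂ) := by
  rw [relativeLaw_real _ _ hX, hT ω ρ, ← integral_complex_ofReal]
  refine integral_congr_ae (.of_forall fun g => ?_)
  simp only [← R₂.covariant g X hX]
  exact (R₂.observable.distribution_spec ρ.toState _ (hX.const_smul g)).symm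

theorem exists_isRelativeOrientation [TopologicalSpace.PseudoMetrizableSpace G]
    (R₁ : Frame G H₁) (R₂ : Frame G H₂) :
    ∃ E : POVM G (HilbertTensor H₁ H₂), IsRelativeOrientation R₁ R₂ E := by
  have h : ∀ X, MeasurableSet X → ∃ T, 0 ≤ T ∧
      R₁.IsRelativization R₂.rep (R₂.observable.effect X) T := fun X hX => by
    -- The integrand lies between 0 and 1 because, by covariance, it is itself an effect of the
    -- second frame.
    refine exists_isTensorIntegral R₁.observable (R₂.rep.continuous_inner_act _) (fun g => ?_)
      fun g => ?_
    · rw [← R₂.covariant g X hX]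
      exact R₂.observable.effect_nonneg (hX.const_smul g)
    · rw [← R₂.covariant g X hX]
      exact R₂.observable.effect_le_one (hX.const_smul g)
  choose! T h0 hT using h
  obtain ⟨E, hE⟩ := exists_povm_of_isTensorIntegral R₁.observable
    (fun X g => R₂.rep.act g (R₂.observable.effect X)) T hT h0
    (fun ω ρ => relativeLaw (R₁.observable.distribution ω.toState)
      (R₂.observable.distribution ρ.toState)) fun ω ρ X hX => trace_relativization hX (hT X hX) ω ρ
  exact ⟨E, fun X hX => hE ▸ hT X hX⟩

theorem eq_of_real_eq {S : Type*} [MeasurableSpace S] {μ ν : ProbabilityMeasure S}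
    (h : ∀ X, MeasurableSet X → (μ : Measure S).real X = (ν : Measure S).real X) : μ = ν :=
  Subtype.ext <| Measure.ext fun X hX =>
    (ENNReal.toReal_eq_toReal_iff' (measure_ne_top (μ : Measure S) _)
      (measure_ne_top (ν : Measure S) _)).1 (h X hX)

theorem distribution_relativeOrientation {R₁ : Frame G H₁} {R₂ : Frame G H₂}
    {E : POVM G (HilbertTensor H₁ H₂)} (hE : IsRelativeOrientation R₁ R₂ E) (ω : PureState H₁)
    (ρ : PureState H₂) :
    E.distribution (ω.tensor ρ).toState = relativeLaw (R₁.observable.distribution ω.toState)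
      (R₂.observable.distribution ρ.toState) :=
  eq_of_real_eq fun X hX => by
    have h := (E.distribution_spec (ω.tensor ρ).toState X hX).trans
      (trace_relativization hX (hE X hX) ω ρ)
    exact_mod_cast h

-- Moving U(h⁻¹) from the vector to the effect gives E(h⁻¹X) by covariance, and h⁻¹X is the preimage
-- of X under left translation by h. Applying covariance at h⁻¹ directly avoids comparing U(h⁻¹)*
-- with U(h), which may differ by a phase.
omit [SecondCountableTopology G] in
theorem distribution_actState (R : Frame G H₂) (h : G) (ρ : PureState H₂) :
    R.observable.distribution (R.rep.actState h⁻¹ ρ).toState =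
      (R.observable.distribution ρ.toState).map
        (continuous_const_mul h).measurable.aemeasurable :=
  eq_of_real_eq fun X hX => by
    obtain ⟨η, -, hη⟩ := ρ.exists_vector
    have hη' : (R.rep.actState h⁻¹ ρ).op = InnerProductSpace.rankOne ℂ
        (star (R.rep.U h⁻¹ : H₂ →L[ℂ] H₂) η) (star (R.rep.U h⁻¹ : H₂ →L[ℂ] H₂) η) := by
      change star (R.rep.U h⁻¹ : H₂ →L[ℂ] H₂) * ρ.op * (R.rep.U h⁻¹ : H₂ →L[ℂ] H₂) = _
      ext x
      rw [hη]
      simp [ContinuousLinearMap.star_eq_adjoint, ContinuousLinearMap.adjoint_inner_left]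
    have h1 := R.observable.inner_effect hη' hX
    have h2 := R.observable.inner_effect hη (hX.const_smul h⁻¹)
    rw [R.covariant _ _ hX] at h2
    rw [ContinuousLinearMap.star_eq_adjoint, ContinuousLinearMap.adjoint_inner_left,
      ← ContinuousLinearMap.star_eq_adjoint] at h1
    have h3 : (h * ·) ⁻¹' X = h⁻¹ • X := Set.preimage_smul h X
    rw [measureReal_def, measureReal_def, ProbabilityMeasure.toMeasure_map,
      Measure.map_apply (continuous_const_mul h).measurable hX, h3]
    exact_mod_cast h1.symm.trans h2

omit [SecondCountableTopology G] in
theorem isLocalizingSequence_actState (R : Frame G H₂) {ρ : ℕ → PureState H₂}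
    (hρ : R.observable.IsLocalizingSequence 1 ρ) (h : G) :
    R.observable.IsLocalizingSequence h fun n => R.rep.actState h⁻¹ (ρ n) := by
  have hd : (diracProba (1 : G)).map (continuous_const_mul h).measurable.aemeasurable =
      diracProba h := by
    apply Subtype.ext
    change Measure.map _ (Measure.dirac 1) = Measure.dirac h
    rw [Measure.map_dirac' (continuous_const_mul h).measurable, mul_one]
  have := ProbabilityMeasure.tendsto_map_of_tendsto_of_continuous _ _ hρ (continuous_const_mul h)
  rw [hd] at this
  exact this.congr fun n => (distribution_actState R h (ρ n)).symm

end RelativeOrientation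

end

end QRF

theorem mainTheorem12
    {G : Type*} [Group G] [TopologicalSpace G] [IsTopologicalGroup G] [LocallyCompactSpace G]
    [SecondCountableTopology G] [T2Space G] [MeasurableSpace G] [BorelSpace G]
    {H₁ : Type*} [NormedAddCommGroup H₁] [InnerProductSpace ℂ H₁] [CompleteSpace H₁]
    [TopologicalSpace.SeparableSpace H₁]
    {H₂ : Type*} [NormedAddCommGroup H₂] [InnerProductSpace ℂ H₂] [CompleteSpace H₂]
    [TopologicalSpace.SeparableSpace H₂]
    (R₁ : QRF.Frame G H₁) (R₂ : QRF.Frame G H₂)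
    (loc₁ : R₁.observable.IsLocalizable) (loc₂ : R₂.observable.IsLocalizable)
    (ω : ℕ → QRF.PureState H₁) (ρ : ℕ → QRF.PureState H₂)
    (hω : R₁.observable.IsLocalizingSequence 1 ω)
    (hρ : R₂.observable.IsLocalizingSequence 1 ρ) :
    ∃ E : QRF.POVM G (QRF.HilbertTensor H₁ H₂), QRF.IsRelativeOrientation R₁ R₂ E ∧
      ∀ h : G,
        Tendsto
          (fun p : ℕ × ℕ =>
            E.distribution ((ω p.1).tensor (R₂.rep.actState h⁻¹ (ρ p.2))).toState)
          (atTop ×ˢ atTop) (𝓝 (diracProba h)) := by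
  obtain ⟨E, hE⟩ := QRF.exists_isRelativeOrientation R₁ R₂
  refine ⟨E, hE, fun h => ?_⟩
  simp only [QRF.distribution_relativeOrientation hE]
  -- The laws of the two frames converge along the two projections of the product filter, so joint
  -- continuity gives the double limit, with no iterated limits. Its value is δ at e⁻¹h = h.
  have lim := QRF.tendsto_relativeLaw (l := (atTop : Filter ℕ) ×ˢ (atTop : Filter ℕ))
    (Tendsto.comp hω tendsto_fst)
    (Tendsto.comp (QRF.isLocalizingSequence_actState R₂ hρ h) tendsto_snd)
  rwa [QRF.relativeLaw_diracProba, inv_one, one_mul] at lim
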